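/- \textbf{Theorem.} All topological spaces below are assumed to be Hausdorff. Call a function $f\colon X\times Y\to Z$ \emph{separately continuous} if $x\mapsto f(x,y)$ is continuous on $X$ for every $y\in Y$ and $y\mapsto f(x,y)$ is continuous on $Y$ for every $x\in X$. Call a space $X$ \emph{weakly Namioka} if for every second countable space $Y$, every metric space $Z$ and every separately continuous function $f\colon X\times Y\to Z$ there is a dense $G_\delta$ subset $D$ of $X$ such that $f$ (as a function on $X\times Y$) is continuous at every point of $D\times Y$. Let $X$ be a space that is either completely regular and separable, or perfectly normal (that is, normal with every closed set a $G_\delta$). Then $X$ is a Baire space (every countable intersection of dense open subsets of $X$ is dense) if and only if $X$ is weakly Namioka. -/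

import Mathlib

universe u v w

/-- A function on a product is separately continuous if it is continuous in each variable when the
other variable is fixed. -/
def SeparatelyContinuous {X : Type u} {Y : Type v} {Z : Type w}
    [TopologicalSpace X] [TopologicalSpace Y] [TopologicalSpace Z] (f : X × Y → Z) : Prop :=
  (∀ y : Y, Continuous fun x : X => f (x, y)) ∧ (∀ x : X, Continuous fun y : Y => f (x, y))

/-- `X` is weakly Namioka: for every second countable (Hausdorff) space `Y` and metric space `Z`,
every separately continuous `f : X × Y → Z` is jointly continuous at each point of `D × Y`, for
some dense Gδ subset `D` of `X`. -/
def WeaklyNamioka (X : Type u) [TopologicalSpace X] : Prop :=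
  ∀ (Y : Type v) [TopologicalSpace Y] [T2Space Y] [SecondCountableTopology Y]
    (Z : Type w) [MetricSpace Z] (f : X × Y → Z), SeparatelyContinuous f →
      ∃ D : Set X, Dense D ∧ IsGδ D ∧ ∀ x ∈ D, ∀ y : Y, ContinuousAt f (x, y)

open Set Filter Topology

/-! Baire gives weakly Namioka: for closed sets of `x` where `f (x, ·)` has small oscillation on a
basic open set, only countably many nowhere dense frontiers must be avoided. Conversely, if `g`
vanishes off `U` and is nonzero on a dense set, `normalizedProduct (g x) t` is jointly discontinuous
at `(x, 0)` for every `x ∉ U`, which forces `D ⊆ U`. -/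

/-- Every Baire space is weakly Namioka. -/
theorem BaireSpace.weaklyNamioka (X : Type u) [TopologicalSpace X] [BaireSpace X] :
    WeaklyNamioka.{u, v, w} X := by
  intro Y _ _ _ Z _ f hf
  let B := TopologicalSpace.countableBasis Y
  have hB : TopologicalSpace.IsTopologicalBasis B := TopologicalSpace.isBasis_countableBasis Y
  have : Countable B := (TopologicalSpace.countable_countableBasis Y).to_subtype
  let A : ℕ × B → Set X := fun p =>
    {x | ∀ y ∈ p.2.1, ∀ y' ∈ p.2.1, dist (f (x, y)) (f (x, y')) ≤ 1 / ((p.1 : ℝ) + 1)}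
  have hA : ∀ p, IsClosed (A p) := by
    intro p
    simp only [A, ofPred_forall]
    exact isClosed_iInter fun y => isClosed_iInter fun _ => isClosed_iInter fun y' =>
      isClosed_iInter fun _ => isClosed_le ((hf.1 y).dist (hf.1 y')) continuous_const
  have hdense : ∀ p, Dense (frontier (A p))ᶜ := fun p =>
    interior_eq_empty_iff_dense_compl.1 (interior_frontier (hA p))
  refine ⟨⋂ p, (frontier (A p))ᶜ,
    dense_iInter_of_isOpen (fun p => isClosed_frontier.isOpen_compl) hdense,
    IsGδ.iInter_of_isOpen fun p => isClosed_frontier.isOpen_compl, fun x hx y => ?_⟩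
  rw [Metric.continuousAt_iff']
  intro ε hε
  obtain ⟨n, hn⟩ := exists_nat_one_div_lt (show 0 < ε / 2 by positivity)
  have hr : (0 : ℝ) < 1 / ((n : ℝ) + 1) := by positivity
  have hball : ∀ᶠ y' in 𝓝 y, dist (f (x, y')) (f (x, y)) < 1 / ((n : ℝ) + 1) / 2 :=
    Metric.continuousAt_iff'.1 (hf.2 x).continuousAt _ (half_pos hr)
  obtain ⟨V, hVB, hyV, hV⟩ := hB.mem_nhds_iff.1 hball
  have hxA : x ∈ A (n, ⟨V, hVB⟩) := fun a ha b hb => by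
    have h₁ : dist (f (x, a)) (f (x, y)) < _ := hV ha
    have h₂ : dist (f (x, b)) (f (x, y)) < _ := hV hb
    have := dist_triangle_right (f (x, a)) (f (x, b)) (f (x, y))
    dsimp only
    linarith
  -- Off the frontier, membership in the closed set persists near `x`, so the oscillation bound is
  -- uniform in `x'`.
  have hxi : x ∈ interior (A (n, ⟨V, hVB⟩)) := by
    rw [← self_sdiff_frontier]
    exact ⟨hxA, mem_iInter.1 hx _⟩
  have hnear : ∀ᶠ x' in 𝓝 x, dist (f (x', y)) (f (x, y)) < ε / 2 :=
    Metric.continuousAt_iff'.1 (hf.1 y).continuousAt _ (half_pos hε)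
  rw [nhds_prod_eq]
  filter_upwards [prod_mem_prod (inter_mem hnear (mem_interior_iff_mem_nhds.1 hxi))
    ((hB.isOpen hVB).mem_nhds hyV)]
  rintro ⟨x', y'⟩ ⟨⟨h₁, h₂⟩, hy'⟩
  have h₃ : dist (f (x', y')) (f (x', y)) ≤ 1 / ((n : ℝ) + 1) := h₂ y' hy' y hyV
  have h₄ : dist (f (x', y)) (f (x, y)) < ε / 2 := h₁
  linarith [dist_triangle (f (x', y')) (f (x', y)) (f (x, y))]

/-- In a completely regular separable space, every dense open set contains a dense cozero set. -/
theorem exists_continuous_dense_support_of_separable {X : Type*} [TopologicalSpace X]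
    [CompletelyRegularSpace X] [TopologicalSpace.SeparableSpace X] {U : Set X}
    (hU : IsOpen U) (hd : Dense U) :
    ∃ g : X → ℝ, Continuous g ∧ (∀ x ∉ U, g x = 0) ∧ Dense {x | g x ≠ 0} := by
  rcases isEmpty_or_nonempty X with _ | _
  · exact ⟨fun _ => 0, continuous_const, fun _ _ => rfl, fun x => isEmptyElim x⟩
  let q := TopologicalSpace.denseSeq X
  have hφ : ∀ n, ∃ φ : X → ℝ, Continuous φ ∧ (∀ x, 0 ≤ φ x) ∧ (∀ x, φ x ≤ 1) ∧
      (∀ x ∉ U, φ x = 0) ∧ (q n ∈ U → φ (q n) = 1) := by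
    intro n
    by_cases hq : q n ∈ U
    · obtain ⟨ψ, hψ, hψq, hψU⟩ :=
        CompletelyRegularSpace.completely_regular (q n) Uᶜ hU.isClosed_compl (by simpa using hq)
      refine ⟨fun x => 1 - ψ x, by fun_prop, fun x => sub_nonneg.2 (ψ x).2.2,
        fun x => sub_le_self _ (ψ x).2.1, fun x hx => ?_, fun _ => by simp [hψq]⟩
      have := hψU hx
      simp [this]
    · exact ⟨fun _ => 0, continuous_const, fun _ => le_rfl, fun _ => zero_le_one,
        fun _ _ => rfl, fun h => absurd h hq⟩
  choose φ hc h0 h1 hU0 hq1 using hφ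
  have hb : ∀ n x, ‖(1 / 2 : ℝ) ^ n * φ n x‖ ≤ (1 / 2 : ℝ) ^ n := fun n x => by
    rw [Real.norm_of_nonneg (mul_nonneg (by positivity) (h0 n x))]
    exact mul_le_of_le_one_right (by positivity) (h1 n x)
  refine ⟨fun x => ∑' n, (1 / 2 : ℝ) ^ n * φ n x,
    continuous_tsum (fun n => continuous_const.mul (hc n)) summable_geometric_two hb,
    fun x hx => by simp [hU0 _ x hx], ?_⟩
  -- The sum is positive at each `q n ∈ U`, and these points are dense.
  refine ((TopologicalSpace.denseRange_denseSeq X).inter_of_isOpen_right hd hU).mono ?_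
  rintro _ ⟨⟨n, rfl⟩, hn⟩
  have hs : Summable fun k => (1 / 2 : ℝ) ^ k * φ k (q n) :=
    Summable.of_norm_bounded summable_geometric_two fun k => hb k _
  refine (hs.tsum_pos (fun k => mul_nonneg (by positivity) (h0 k _)) n ?_).ne'
  rw [hq1 n hn]
  positivity

/-- In a perfectly normal space, every dense open set contains a dense cozero set. -/
theorem exists_continuous_dense_support_of_perfectlyNormal {X : Type*} [TopologicalSpace X]
    [PerfectlyNormalSpace X] {U : Set X} (hU : IsOpen U) (hd : Dense U) :
    ∃ g : X → ℝ, Continuous g ∧ (∀ x ∉ U, g x = 0) ∧ Dense {x | g x ≠ 0} := by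
  obtain ⟨g, hg, -⟩ := perfectlyNormalSpace_iff_forall_isClosed_preimage_zero.1
    ‹_› Uᶜ hU.isClosed_compl
  have hiff : ∀ x, x ∉ U ↔ g x = 0 := fun x => by
    simpa using Set.ext_iff.1 hg x
  refine ⟨g, g.continuous, fun x => (hiff x).1, hd.mono fun x hx h => (hiff x).2 h hx⟩

/-- The standard separately continuous function on the plane that is discontinuous at `0`. -/
noncomputable def normalizedProduct (s t : ℝ) : ℝ := 2 * s * t / (s ^ 2 + t ^ 2)

theorem normalizedProduct_comm (s t : ℝ) : normalizedProduct s t = normalizedProduct t s := by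
  unfold normalizedProduct
  ring_nf

theorem continuous_normalizedProduct_right (s : ℝ) : Continuous (normalizedProduct s) := by
  unfold normalizedProduct
  rcases eq_or_ne s 0 with rfl | hs
  · simpa using continuous_const
  · exact Continuous.div (by fun_prop) (by fun_prop) fun t => by positivity

theorem continuous_normalizedProduct_left (t : ℝ) : Continuous fun s => normalizedProduct s t := by
  simpa only [normalizedProduct_comm _ t] using continuous_normalizedProduct_right t

theorem normalizedProduct_self {s : ℝ} (hs : s ≠ 0) : normalizedProduct s s = 1 := by
  unfold normalizedProduct
  field_simp
  norm_num

/-- A weakly Namioka space in which every dense open set contains a dense cozero set is a Baire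
space. -/
theorem WeaklyNamioka.baireSpace {X : Type u} [TopologicalSpace X]
    (hX : ∀ U : Set X, IsOpen U → Dense U →
      ∃ g : X → ℝ, Continuous g ∧ (∀ x ∉ U, g x = 0) ∧ Dense {x | g x ≠ 0})
    (h : WeaklyNamioka.{u, v, w} X) : BaireSpace X := by
  refine ⟨fun U hU hd => ?_⟩
  choose g hgc hg0 hgd using fun n => hX (U n) (hU n) (hd n)
  -- The factor `ℕ` encodes all the `U n` in one function, so a single `D` lies in every `U n`.
  let f : X × ULift.{v} (ℕ × ℝ) → ULift.{w} ℝ := fun p =>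
    ⟨normalizedProduct (g p.2.down.1 p.1) p.2.down.2⟩
  have hf : SeparatelyContinuous f := by
    refine ⟨fun y => continuous_uliftUp.comp
      ((continuous_normalizedProduct_left y.down.2).comp (hgc y.down.1)), fun x => continuous_uliftUp.comp ?_⟩
    have hprod : Continuous fun p : ℕ × ℝ => normalizedProduct (g p.1 x) p.2 :=
      continuous_prod_of_discrete_left.2 fun n => continuous_normalizedProduct_right (g n x)
    exact hprod.comp continuous_uliftDown
  obtain ⟨D, hDd, -, hD⟩ := h _ _ f hf
  refine hDd.mono fun x hx => mem_iInter.2 fun n => ?_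
  by_contra hxn
  have hgx : g n x = 0 := hg0 n x hxn
  -- Along this curve `f` is `1` on a dense set but `0` at `x`.
  have hcurve : Continuous fun x' : X => (x', (⟨(n, g n x')⟩ : ULift.{v} (ℕ × ℝ))) :=
    continuous_id.prodMk (continuous_uliftUp.comp (continuous_const.prodMk (hgc n)))
  have hcont : ContinuousAt (fun x' => normalizedProduct (g n x') (g n x')) x :=
    continuous_uliftDown.continuousAt.comp
      ((hD x hx ⟨(n, g n x)⟩).comp_of_eq hcurve.continuousAt rfl)
  have hlt : ∀ᶠ x' in 𝓝 x, normalizedProduct (g n x') (g n x') < 1 :=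
    hcont.eventually_lt continuousAt_const (by simp [hgx, normalizedProduct])
  obtain ⟨x', hx', hne⟩ := (hgd n).inter_nhds_nonempty hlt
  exact absurd (normalizedProduct_self hx') (ne_of_lt hne)

theorem mainTheorem1 (X : Type u) [TopologicalSpace X] [T2Space X]
    (hX : (CompletelyRegularSpace X ∧ TopologicalSpace.SeparableSpace X) ∨
      PerfectlyNormalSpace X) :
    BaireSpace X ↔ WeaklyNamioka.{u, v, w} X := by
  refine ⟨fun _ => BaireSpace.weaklyNamioka X, WeaklyNamioka.baireSpace fun U hU hd => ?_⟩
  rcases hX with ⟨_, _⟩ | _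
  · exact exists_continuous_dense_support_of_separable hU hd
  · exact exists_continuous_dense_support_of_perfectlyNormal hU hd
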